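/- Call a monic real polynomial $P$ of degree $n$ *realizable* if it is the characteristic polynomial of an entrywise nonnegative real $n\times n$ matrix, and *irreducibly realizable* if it is the characteristic polynomial of an irreducible entrywise nonnegative real $n\times n$ matrix (equivalently, of the adjacency matrix of a strongly connected digraph on $n$ vertices with positive weights). Let $p\ge 3$, let $k_p,k_{p+1},\dots,k_{2p}\in\mathbb{R}$, and let $$P(x)=x^{2p}+k_p x^{p}+k_{p+1}x^{p-1}+\dots+k_{2p-1}x+k_{2p}\neq x^{2p}.$$ (i) Unless $k_p<0$, $k_{p+1}=\dots=k_{2p-1}=0$ and $k_{2p}=\frac{k_p^2}{4}$, the polynomial $P$ is realizable if and only if it is irreducibly realizable. (ii) If $k_p<0$, $k_{p+1}=\dots=k_{2p-1}=0$ and $k_{2p}=\frac{k_p^2}{4}$, then $P(x)=\left(x^p+\frac{k_p}{2}\right)^2$, and $P$ is realizable but not irreducibly realizable. -/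

import Mathlib

open Polynomial

/-- `P` is realizable: it is the characteristic polynomial of an entrywise nonnegative real
`n × n` matrix. -/
def IsRealizable (n : ℕ) (P : ℝ[X]) : Prop :=
  ∃ A : Matrix (Fin n) (Fin n) ℝ, (∀ i j, 0 ≤ A i j) ∧ A.charpoly = P

/-- `P` is irreducibly realizable: it is the characteristic polynomial of an irreducible
entrywise nonnegative real `n × n` matrix. Here `Matrix.IsIrreducible` includes entrywise
nonnegativity and says that the digraph of positive entries is strongly connected. -/
def IsIrreduciblyRealizable (n : ℕ) (P : ℝ[X]) : Prop :=
  ∃ A : Matrix (Fin n) (Fin n) ℝ, A.IsIrreducible ∧ A.charpoly = P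

/-- The polynomial `x^(2p) + k_p x^p + k_(p+1) x^(p-1) + ⋯ + k_(2p-1) x + k_(2p)`; only the
values `k i` with `p ≤ i ≤ 2p` matter. -/
noncomputable def evenPoly (p : ℕ) (k : ℕ → ℝ) : ℝ[X] :=
  X ^ (2 * p) + ∑ i ∈ Finset.Icc p (2 * p), C (k i) * X ^ (2 * p - i)

/-- The exceptional coefficients: `k_p < 0`, `k_(p+1) = ⋯ = k_(2p-1) = 0` and
`k_(2p) = k_p² / 4`. -/
def IsExceptional (p : ℕ) (k : ℕ → ℝ) : Prop :=
  k p < 0 ∧ (∀ i, p < i → i < 2 * p → k i = 0) ∧ k (2 * p) = k p ^ 2 / 4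

/-! Necessity: Newton's identities turn the gap in `P` into `tr A^m = -m k_m` for `p ≤ m < 2p`, so
these `k_m` are nonpositive. They also give the first two power sums of the spectrum of `A^p`;
comparing with its diagonal yields `k_(2p) ≤ k_p²/4` (`sum_sq_diag_pow_le_of_charpoly_eq_evenPoly`).

Sufficiency: under these inequalities `P` comes from a path with edges back to its start and one
extra edge leaving its end (`charpoly_loopedPathMatrix`). If `k_p < 0`, two disjoint `p`-cycles of
weight `-k_p/2` absorb `k_p` and `k_p²/4`, and the other back edges carry nonnegative weights. One
of these is positive unless `P` is exceptional, and it makes the digraph strongly connected. If `k_p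
= 0`, two overlapping cycles of a length `l > p` do the same.

Exception: equality forces the diagonal of `A^p` to be constant. Irreducibility then makes `A^p` a
scalar matrix, which is impossible for size `2p > p`. -/

namespace Matrix

/-! ### Newton's identities for the characteristic polynomial -/

section Newton

variable {n R : Type*} [Fintype n] [DecidableEq n] [CommRing R]

/-- Jacobi's formula for the characteristic matrix. -/
theorem derivative_charpoly_eq_trace_adjugate (A : Matrix n n R) :
    derivative A.charpoly = A.charmatrix.adjugate.trace := by
  have hd : ∀ i j : n, derivative (A.charmatrix i j) = if i = j then 1 else 0 := by
    intro i j
    by_cases h : i = j <;> simp [h]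
  -- The diagonal cofactor replaces column `j` by `e_j`, which is the derivative of that column.
  have hcol : ∀ j : n, A.charmatrix.adjugate j j =
      ∑ σ : Equiv.Perm n, Equiv.Perm.sign σ •
        ((∏ i ∈ Finset.univ.erase j, A.charmatrix (σ i) i) *
          derivative (A.charmatrix (σ j) j)) := by
    intro j
    have h : A.charmatrix.adjugate j j = (A.charmatrix.updateCol j (Pi.single j 1)).det := by
      rw [← cramer_apply, cramer_eq_adjugate_mulVec]
      simp
    rw [h, det_apply]
    refine Finset.sum_congr rfl fun σ _ => ?_
    rw [← Finset.prod_erase_mul _ _ (Finset.mem_univ j), hd]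
    congr 2
    · refine Finset.prod_congr rfl fun i hi => ?_
      rw [updateCol_ne (Finset.ne_of_mem_erase hi)]
    · simp [Pi.single_apply]
  rw [charpoly, det_apply, trace, derivative_sum]
  simp only [diag_apply, hcol]
  rw [Finset.sum_comm]
  refine Finset.sum_congr rfl fun σ _ => ?_
  rw [derivative_smul, derivative_prod_finset, Finset.smul_sum]

/-- Compare coefficients of `X^(i+1)` in `(X - A) * adj(X - A) = charpoly * 1`. -/
theorem coeff_matPolyEquiv_adjugate_charmatrix (A : Matrix n n R) (i : ℕ) :
    (matPolyEquiv A.charmatrix.adjugate).coeff i =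
      A * (matPolyEquiv A.charmatrix.adjugate).coeff (i + 1) + A.charpoly.coeff (i + 1) • 1 := by
  have h := congrArg matPolyEquiv (mul_adjugate A.charmatrix)
  rw [map_mul, matPolyEquiv_charmatrix] at h
  have h2 := congrArg (fun q => q.coeff (i + 1)) h
  simp only [sub_mul, coeff_sub, coeff_X_mul, coeff_C_mul] at h2
  rw [sub_eq_iff_eq_add'] at h2
  rw [h2]
  congr 1
  ext a b
  rw [matPolyEquiv_coeff_apply]
  by_cases hab : a = b <;> simp [hab, charpoly]

theorem coeff_matPolyEquiv_adjugate_charmatrix_of_le [Nontrivial R] (A : Matrix n n R) {i : ℕ}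
    (hi : Fintype.card n ≤ i) : (matPolyEquiv A.charmatrix.adjugate).coeff i = 0 := by
  set Q := matPolyEquiv A.charmatrix.adjugate with hQ
  -- Beyond the degree of `charpoly` the recursion is `Q_i = A * Q_(i+1)`, so vanishing descends
  -- from a large index.
  have key : ∀ m j, Q.coeff j = 0 → j ≤ i + m → i ≤ j → Q.coeff i = 0 := by
    intro m
    induction m with
    | zero => intro j hj h1 h2; obtain rfl : j = i := by omega
              exact hj
    | succ m ih =>
      intro j hj h1 h2
      rcases h2.eq_or_lt with rfl | h2
      · exact hj
      obtain ⟨j, rfl⟩ : ∃ j', j = j' + 1 := ⟨j - 1, by omega⟩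
      refine ih j ?_ (by omega) (by omega)
      rw [hQ, coeff_matPolyEquiv_adjugate_charmatrix, ← hQ, hj,
        coeff_eq_zero_of_natDegree_lt (by rw [charpoly_natDegree_eq_dim]; omega)]
      simp
  exact key (Q.natDegree + 1) (i + Q.natDegree + 1) (coeff_eq_zero_of_natDegree_lt (by omega))
    (by omega) (by omega)

theorem coeff_matPolyEquiv_adjugate_charmatrix_eq_sum [Nontrivial R] (A : Matrix n n R)
    (m i : ℕ) (h : i + m + 1 = Fintype.card n) :
    (matPolyEquiv A.charmatrix.adjugate).coeff i =
      ∑ r ∈ Finset.range (m + 1), A.charpoly.coeff (Fintype.card n - r) • A ^ (m - r) := by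
  induction m generalizing i with
  | zero =>
    rw [coeff_matPolyEquiv_adjugate_charmatrix,
      coeff_matPolyEquiv_adjugate_charmatrix_of_le A (by omega)]
    simp [← h]
  | succ m ih =>
    rw [coeff_matPolyEquiv_adjugate_charmatrix, ih (i + 1) (by omega),
      Finset.sum_range_succ _ (m + 1), Finset.mul_sum]
    congr 1
    · refine Finset.sum_congr rfl fun r hr => ?_
      rw [Finset.mem_range] at hr
      rw [mul_smul_comm, ← pow_succ', show m + 1 - r = m - r + 1 by omega]
    · rw [show Fintype.card n - (m + 1) = i + 1 by omega]
      simp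

/-- **Newton's identities** relating the coefficients of the characteristic polynomial of a matrix
to the traces of its powers. -/
theorem sum_charpoly_coeff_mul_trace_pow [Nontrivial R] (A : Matrix n n R) (m : ℕ)
    (hm : m ≤ Fintype.card n) :
    ∑ r ∈ Finset.range (m + 1), A.charpoly.coeff (Fintype.card n - r) * (A ^ (m - r)).trace =
      (Fintype.card n - m : ℕ) * A.charpoly.coeff (Fintype.card n - m) := by
  have htr : ∀ s : Finset ℕ, ∑ r ∈ s,
      A.charpoly.coeff (Fintype.card n - r) * (A ^ (m - r)).trace =
      (∑ r ∈ s, A.charpoly.coeff (Fintype.card n - r) • A ^ (m - r)).trace := by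
    intro s
    simp [trace_sum]
  rw [htr]
  -- The top case is Cayley–Hamilton; below it, the sum is the trace of an adjugate coefficient,
  -- hence a coefficient of the derivative.
  rcases hm.eq_or_lt with rfl | hm
  · have h := aeval_self_charpoly A
    rw [aeval_eq_sum_range, charpoly_natDegree_eq_dim, ← Finset.sum_range_reflect] at h
    have h0 : ∑ r ∈ Finset.range (Fintype.card n + 1),
        A.charpoly.coeff (Fintype.card n - r) • A ^ (Fintype.card n - r) = 0 := by
      simpa using h
    rw [h0]
    simp
  · obtain ⟨i, hi⟩ : ∃ i, i + m + 1 = Fintype.card n := ⟨Fintype.card n - m - 1, by omega⟩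
    rw [← coeff_matPolyEquiv_adjugate_charmatrix_eq_sum A m i hi]
    have h := congrArg (fun q => q.coeff i) (derivative_charpoly_eq_trace_adjugate A)
    simp only [coeff_derivative, trace, diag_apply, finsetSum_coeff] at h
    simp only [trace, diag_apply, matPolyEquiv_coeff_apply]
    rw [← h, show Fintype.card n - m = i + 1 by omega]
    push_cast
    ring

/-- Newton's identities with the extreme terms split off. -/
theorem trace_pow_eq [Nontrivial R] (A : Matrix n n R) (m : ℕ) (hm0 : 0 < m)
    (hm : m ≤ Fintype.card n) :
    (A ^ m).trace = -(m * A.charpoly.coeff (Fintype.card n - m)) -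
      ∑ r ∈ Finset.Ico 1 m, A.charpoly.coeff (Fintype.card n - r) * (A ^ (m - r)).trace := by
  have h := sum_charpoly_coeff_mul_trace_pow A m hm
  have hlead : A.charpoly.coeff (Fintype.card n) = 1 := by
    have := charpoly_monic A
    rwa [Monic, leadingCoeff, charpoly_natDegree_eq_dim] at this
  rw [Finset.sum_range_succ, Finset.range_eq_Ico, Finset.sum_eq_sum_Ico_succ_bot hm0] at h
  simp only [Nat.sub_zero, hlead, Nat.sub_self, pow_zero, trace_one, one_mul, zero_add,
    Nat.cast_sub hm] at h
  linear_combination h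

end Newton

end Matrix

/-! ### Hessenberg determinants and strong connectivity -/

namespace Matrix

/-- A lower Hessenberg matrix with `-1` on the superdiagonal has the determinant `w`, if it maps a
vector with first entry `1` to the vector with last entry `w` and all other entries zero. -/
theorem det_eq_of_lower_hessenberg {R : Type*} [CommRing R] {N : ℕ}
    (M : Matrix (Fin (N + 1)) (Fin (N + 1)) R) (v : Fin (N + 1) → R) (w : R)
    (hzero : ∀ i j : Fin (N + 1), (i : ℕ) + 1 < j → M i j = 0)
    (hsuper : ∀ i j : Fin (N + 1), (j : ℕ) = i + 1 → M i j = -1)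
    (hv : v 0 = 1) (hMv : M *ᵥ v = Pi.single (Fin.last N) w) : M.det = w := by
  -- Since `v 0 = 1`, replacing column `0` by `M *ᵥ v` is a column operation; expansion along it
  -- leaves one triangular minor.
  have h1 : (M.updateCol 0 (M *ᵥ v)).det = M.det := by
    rw [← cramer_apply, cramer_eq_adjugate_mulVec, mulVec_mulVec, adjugate_mul]
    simp [smul_mulVec, hv]
  rw [← h1, hMv, det_succ_column_zero, Finset.sum_eq_single (Fin.last N)]
  · have h2 : ((M.updateCol 0 (Pi.single (Fin.last N) w)).submatrix (Fin.last N).succAbove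
        Fin.succ).det = (-1) ^ N := by
      rw [det_of_isLowerTriangular]
      · simp only [submatrix_apply, Fin.succAbove_last]
        rw [Finset.prod_congr rfl fun i _ => ?_, Finset.prod_const, Finset.card_univ,
          Fintype.card_fin]
        rw [updateCol_ne (Fin.succ_ne_zero i)]
        exact hsuper _ _ (by simp)
      · intro i j hij
        rw [submatrix_apply, updateCol_ne (Fin.succ_ne_zero j)]
        refine hzero _ _ ?_
        have : (i : ℕ) < j := by simpa using hij
        simpa using this
    rw [h2]
    simp only [Fin.val_last, updateCol_self, Pi.single_eq_same]
    rw [mul_right_comm, ← mul_pow]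
    simp
  · intro i _ hi
    simp [Pi.single_eq_of_ne hi]
  · simp

/-- A nonnegative matrix is irreducible if any two indices are linked by a chain of positive
entries. -/
theorem isIrreducible_of_transGen {n R : Type*} [Ring R] [LinearOrder R] {A : Matrix n n R}
    (hA : ∀ i j, 0 ≤ A i j) (h : ∀ i j, Relation.TransGen (fun i j => 0 < A i j) i j) :
    A.IsIrreducible := by
  refine ⟨hA, fun i j => ?_⟩
  let := toQuiver A
  induction h i j with
  | single e => exact ⟨Quiver.Hom.toPath (PLift.up e), by simp⟩
  | tail _ e ih =>
    obtain ⟨q, hq⟩ := ih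
    exact ⟨q.cons (PLift.up e), by simp⟩

end Matrix

/-! ### Looped paths and their characteristic polynomials -/

/-- The weighted digraph on `0, …, N` with the path `0 → 1 → ⋯ → N` of weight one, edges `i → 0` of
weight `c i`, and an additional edge `N → m` of weight `d`. -/
def loopedPathMatrix (N m : ℕ) (c : ℕ → ℝ) (d : ℝ) : Matrix (Fin (N + 1)) (Fin (N + 1)) ℝ :=
  Matrix.of fun i j => (if (j : ℕ) = i + 1 then 1 else 0) + (if (j : ℕ) = 0 then c i else 0) +
    (if (i : ℕ) = N ∧ (j : ℕ) = m then d else 0)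

/-- Horner's scheme for `x ^ n - c 0 * x ^ (n - 1) - ⋯ - c (n - 1)`. -/
noncomputable def hornerPoly (c : ℕ → ℝ) : ℕ → ℝ[X]
  | 0 => 1
  | n + 1 => X * hornerPoly c n - C (c n)

theorem hornerPoly_eq (c : ℕ → ℝ) (n : ℕ) :
    hornerPoly c n = X ^ n - ∑ i ∈ Finset.range n, C (c i) * X ^ (n - 1 - i) := by
  induction n with
  | zero => simp [hornerPoly]
  | succ n ih =>
    rw [hornerPoly, ih, Finset.sum_range_succ, mul_sub, Finset.mul_sum]
    have : ∑ i ∈ Finset.range n, X * (C (c i) * X ^ (n - 1 - i)) =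
        ∑ i ∈ Finset.range n, C (c i) * X ^ (n + 1 - 1 - i) := by
      refine Finset.sum_congr rfl fun i hi => ?_
      rw [Finset.mem_range] at hi
      rw [show n + 1 - 1 - i = n - 1 - i + 1 by omega]
      ring
    rw [this]
    simp only [add_tsub_cancel_right, tsub_self, pow_zero, mul_one]
    ring

section loopedPathMatrix

variable {N m : ℕ} {c : ℕ → ℝ} {d : ℝ}

/-- Each row but the last of the characteristic matrix, applied to the vector of Horner polynomials,
is one step of Horner's recursion. -/
theorem charpoly_loopedPathMatrix (hm : m ≤ N) :
    (loopedPathMatrix N m c d).charpoly = hornerPoly c (N + 1) - C d * hornerPoly c m := by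
  refine Matrix.det_eq_of_lower_hessenberg _ (fun i => hornerPoly c i) _ ?_ ?_ rfl ?_
  · intro i j hij
    have h1 : i ≠ j := by rintro rfl; omega
    rw [Matrix.charmatrix_apply_ne _ _ _ h1, loopedPathMatrix, Matrix.of_apply, if_neg (by omega),
      if_neg (by omega), if_neg (by omega)]
    simp
  · intro i j hij
    have h1 : i ≠ j := by rintro rfl; omega
    rw [Matrix.charmatrix_apply_ne _ _ _ h1, loopedPathMatrix, Matrix.of_apply, if_pos hij,
      if_neg (by omega), if_neg (by omega)]
    simp
  · ext1 i
    have hlast : (∑ j : Fin (N + 1), if (j : ℕ) = i + 1 then hornerPoly c j else 0) =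
        if (i : ℕ) = N then 0 else hornerPoly c (i + 1) := by
      split_ifs with h
      · exact Finset.sum_eq_zero fun j _ => if_neg (by omega)
      · rw [Finset.sum_eq_single ⟨i + 1, by omega⟩]
        · simp
        · intro j _ hj
          exact if_neg fun h' => hj (Fin.ext h')
        · simp
    have hzero : (∑ j : Fin (N + 1), if (j : ℕ) = 0 then C (c i) * hornerPoly c j else 0) =
        C (c i) := by
      rw [Finset.sum_eq_single 0]
      · simp [hornerPoly]
      · intro j _ hj
        exact if_neg fun h' => hj (Fin.ext h')
      · simp
    have hmid : (∑ j : Fin (N + 1), if (i : ℕ) = N ∧ (j : ℕ) = m then C d * hornerPoly c j else 0) =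
        if (i : ℕ) = N then C d * hornerPoly c m else 0 := by
      split_ifs with h
      · rw [Finset.sum_eq_single ⟨m, by omega⟩]
        · simp [h]
        · intro j _ hj
          exact if_neg fun h' => hj (Fin.ext h'.2)
        · simp
      · exact Finset.sum_eq_zero fun j _ => if_neg fun h' => h h'.1
    have hsum : ((loopedPathMatrix N m c d).charmatrix.mulVec fun j => hornerPoly c j) i =
        X * hornerPoly c i -
        ((∑ j : Fin (N + 1), if (j : ℕ) = i + 1 then hornerPoly c j else 0) +
        (∑ j : Fin (N + 1), if (j : ℕ) = 0 then C (c i) * hornerPoly c j else 0) +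
        ∑ j : Fin (N + 1), if (i : ℕ) = N ∧ (j : ℕ) = m then C d * hornerPoly c j else 0) := by
      rw [Matrix.charmatrix, Matrix.sub_mulVec, Pi.sub_apply]
      congr 1
      · simp [Matrix.scalar_apply, Matrix.mulVec_diagonal]
      · simp only [Matrix.mulVec, dotProduct]
        rw [← Finset.sum_add_distrib, ← Finset.sum_add_distrib]
        refine Finset.sum_congr rfl fun j _ => ?_
        simp only [RingHom.mapMatrix_apply, Matrix.map_apply, loopedPathMatrix, Matrix.of_apply,
          map_add, add_mul]
        congr 1
        · congr 1
          · split_ifs <;> simp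
          · split_ifs <;> simp
        · split_ifs <;> simp
    rw [hsum, hlast, hzero, hmid]
    by_cases h : (i : ℕ) = N
    · obtain rfl : i = Fin.last N := Fin.ext h
      simp [hornerPoly]
      ring
    · have : i ≠ Fin.last N := fun h' => h (by simp [h'])
      rw [Pi.single_eq_of_ne this, if_neg h, if_neg h, hornerPoly]
      ring

theorem loopedPathMatrix_nonneg (hc : ∀ i, i < N + 1 → 0 ≤ c i) (hd : 0 ≤ d) (i j : Fin (N + 1)) :
    0 ≤ loopedPathMatrix N m c d i j := by
  rw [loopedPathMatrix, Matrix.of_apply]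
  have := hc i i.2
  split_ifs <;> simp <;> positivity

/-- Any vertex reaches `N`, jumps to `m`, climbs to `l ≥ m`, returns to `0`, and from there reaches
everything. -/
theorem loopedPathMatrix_isIrreducible (hc : ∀ i, i < N + 1 → 0 ≤ c i) (hd : 0 < d)
    {l : ℕ} (hml : m ≤ l) (hl : l ≤ N) (hcl : 0 < c l) : (loopedPathMatrix N m c d).IsIrreducible := by
  refine Matrix.isIrreducible_of_transGen (loopedPathMatrix_nonneg hc hd.le) fun i j => ?_
  have hstep : ∀ a (ha : a + 1 < N + 1), 0 < loopedPathMatrix N m c d ⟨a, by omega⟩ ⟨a + 1, ha⟩ := by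
    intro a ha
    simp only [loopedPathMatrix, Matrix.of_apply]
    have := hc a (by omega)
    split_ifs <;> positivity
  have hup : ∀ a r (h : a + r < N + 1), Relation.ReflTransGen
      (fun i j => 0 < loopedPathMatrix N m c d i j) ⟨a, by omega⟩ ⟨a + r, h⟩ := by
    intro a r
    induction r with
    | zero => intro h; exact .refl
    | succ r ih => intro h; exact (ih (by omega)).tail (hstep (a + r) h)
  have hle : ∀ a b : Fin (N + 1), (a : ℕ) ≤ b → Relation.ReflTransGen
      (fun i j => 0 < loopedPathMatrix N m c d i j) a b := by
    intro a b hab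
    have := hup a (b - a) (by omega)
    rwa [show (⟨a + (b - a), by omega⟩ : Fin (N + 1)) = b from Fin.ext (by simp; omega)] at this
  have hlast : 0 < loopedPathMatrix N m c d (Fin.last N) ⟨m, by omega⟩ := by
    simp only [loopedPathMatrix, Matrix.of_apply, Fin.val_last]
    have := hc N (by omega)
    split_ifs <;> first | positivity | simp_all
  have hback : 0 < loopedPathMatrix N m c d ⟨l, by omega⟩ 0 := by
    simp only [loopedPathMatrix, Matrix.of_apply, Fin.val_zero]
    split_ifs <;> positivity
  refine Relation.TransGen.trans_left (b := 0) ?_ (hle 0 j (Nat.zero_le _))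
  refine .tail' ?_ hback
  exact ((hle i (Fin.last N) (Fin.le_last i)).tail hlast).trans (hle _ _ hml)

end loopedPathMatrix

/-! ### Nonnegative and irreducible matrices -/

namespace Matrix

section Nonneg

variable {n : Type*} [Fintype n]

theorem mul_apply_pos_of_nonneg {A B : Matrix n n ℝ} (hA : ∀ i j, 0 ≤ A i j)
    (hB : ∀ i j, 0 ≤ B i j) {i j l : n} (h1 : 0 < A i j) (h2 : 0 < B j l) : 0 < (A * B) i l := by
  rw [mul_apply]
  exact Finset.sum_pos' (fun r _ => mul_nonneg (hA i r) (hB r l))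
    ⟨j, Finset.mem_univ j, mul_pos h1 h2⟩

theorem sum_sq_diag_sub_le {B : Matrix n n ℝ} (hB : ∀ i j, 0 ≤ B i j) (a : ℝ) :
    ∑ i, (B i i - a) ^ 2 ≤ (B * B).trace - 2 * a * B.trace + Fintype.card n * a ^ 2 := by
  have h1 : ∑ i, B i i ^ 2 ≤ (B * B).trace := by
    refine Finset.sum_le_sum fun i _ => ?_
    rw [diag_apply, mul_apply, sq]
    exact Finset.single_le_sum (f := fun j => B i j * B j i)
      (fun j _ => mul_nonneg (hB i j) (hB j i)) (Finset.mem_univ i)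
  have h2 : ∑ i, (B i i - a) ^ 2 =
      ∑ i, B i i ^ 2 - 2 * a * B.trace + Fintype.card n * a ^ 2 := by
    simp only [sub_sq, Finset.sum_add_distrib, Finset.sum_sub_distrib, trace, diag_apply,
      Finset.mul_sum, Finset.sum_const, Finset.card_univ, nsmul_eq_mul]
    congr 2
    exact Finset.sum_congr rfl fun i _ => by ring
  linarith

variable [DecidableEq n]

/-- If `N i j > 0`, a walk from `j` back to `i` makes `N * A^r * N = A^r * N²` positive at `(i, j)`.
-/
theorem IsIrreducible.eq_zero_of_commute_of_mul_self_eq_zero {A N : Matrix n n ℝ}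
    (hA : A.IsIrreducible) (hN : ∀ i j, 0 ≤ N i j) (hcomm : Commute N A) (hsq : N * N = 0) :
    N = 0 := by
  by_contra hne
  obtain ⟨i, j, hij⟩ : ∃ i j, N i j ≠ 0 := by
    by_contra! h
    exact hne (by ext i j; exact h i j)
  have hpos : 0 < N i j := (hN i j).lt_of_ne' hij
  obtain ⟨r, -, hr⟩ := (isIrreducible_iff_exists_pow_pos hA.nonneg).1 hA j i
  have h1 : 0 < (N * A ^ r * N) i j := by
    refine mul_apply_pos_of_nonneg (fun a b => ?_) hN
      (mul_apply_pos_of_nonneg hN (pow_apply_nonneg hA.nonneg r) hpos hr) hpos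
    rw [mul_apply]
    exact Finset.sum_nonneg fun s _ => mul_nonneg (hN a s) (pow_apply_nonneg hA.nonneg r s b)
  rw [(hcomm.pow_right r).eq, mul_assoc, hsq, mul_zero] at h1
  exact lt_irrefl _ h1

/-- If the `p`-th power of an irreducible matrix is a nonzero scalar, the matrix has size at
most `p`. -/
theorem IsIrreducible.card_le_of_pow_eq_smul_one {A : Matrix n n ℝ} (hA : A.IsIrreducible)
    {p : ℕ} (hp : 0 < p) {a : ℝ} (ha : a ≠ 0) (h : A ^ p = a • (1 : Matrix n n ℝ)) :
    Fintype.card n ≤ p := by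
  rcases isEmpty_or_nonempty n with hn | ⟨⟨i⟩⟩
  · simp
  have hoff : ∀ {x y}, 0 < (A ^ p) x y → x = y := by
    intro x y hxy
    by_contra hne
    simp [h, one_apply_ne hne] at hxy
  -- As `A^p` is scalar, walk lengths may be reduced mod `p`.
  have hreach : ∀ j, ∃ r : Fin p, 0 < (A ^ (r : ℕ)) i j := by
    intro j
    obtain ⟨s, -, hs⟩ := (isIrreducible_iff_exists_pow_pos hA.nonneg).1 hA i j
    refine ⟨⟨s % p, Nat.mod_lt _ hp⟩, ?_⟩
    rw [← Nat.mod_add_div s p, pow_add, pow_mul, h, _root_.smul_pow, one_pow, mul_smul_comm, mul_one,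
      smul_apply, smul_eq_mul] at hs
    exact (pow_apply_nonneg hA.nonneg _ i j).lt_of_ne' (right_ne_zero_of_mul hs.ne')
  choose r hr using hreach
  -- From `j`, some walk of length `p - r j` must end at `i`; following it by the walk to `j'` gives
  -- length `p`, so `j = j'`.
  have hinj : Function.Injective r := by
    intro j j' hjj'
    have hsum : A ^ (p - r j) * A ^ (r j : ℕ) = A ^ p := by
      rw [← pow_add, Nat.sub_add_cancel (r j).2.le]
    have hsum' : A ^ (r j : ℕ) * A ^ (p - r j) = A ^ p := by
      rw [← pow_add, Nat.add_sub_cancel' (r j).2.le]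
    have hjj : (A ^ (p - r j) * A ^ (r j : ℕ)) j j ≠ 0 := by simpa [hsum, h] using ha
    rw [mul_apply] at hjj
    obtain ⟨l, -, hl⟩ := Finset.exists_ne_zero_of_sum_ne_zero hjj
    have hjl : 0 < (A ^ (p - r j)) j l :=
      (pow_apply_nonneg hA.nonneg _ j l).lt_of_ne' (left_ne_zero_of_mul hl)
    have hil : i = l := hoff (hsum' ▸ mul_apply_pos_of_nonneg (pow_apply_nonneg hA.nonneg _)
      (pow_apply_nonneg hA.nonneg _) (hr j) hjl)
    subst hil
    have hr' := hr j'
    rw [← hjj'] at hr'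
    exact hoff (hsum ▸ mul_apply_pos_of_nonneg (pow_apply_nonneg hA.nonneg _)
      (pow_apply_nonneg hA.nonneg _) hjl hr')
  simpa using Fintype.card_le_of_injective r hinj

end Nonneg

end Matrix

/-! ### Necessary conditions and the exceptional case -/

section evenPoly

variable {p : ℕ} {k : ℕ → ℝ}

theorem evenPoly_coeff {r : ℕ} (hr0 : 0 < r) (hr : r ≤ 2 * p) :
    (evenPoly p k).coeff (2 * p - r) = if r < p then 0 else k r := by
  rw [evenPoly, coeff_add, finsetSum_coeff, coeff_X_pow, if_neg (by omega), zero_add]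
  simp only [coeff_C_mul, coeff_X_pow, mul_ite, mul_one, mul_zero]
  split_ifs with h
  · refine Finset.sum_eq_zero fun i hi => if_neg ?_
    rw [Finset.mem_Icc] at hi
    omega
  · rw [Finset.sum_eq_single r]
    · simp
    · intro i hi hir
      rw [Finset.mem_Icc] at hi
      exact if_neg (by omega)
    · intro hi
      rw [Finset.mem_Icc] at hi
      omega

variable {A : Matrix (Fin (2 * p)) (Fin (2 * p)) ℝ}

theorem trace_pow_of_charpoly_eq_evenPoly (hA : A.charpoly = evenPoly p k) {m : ℕ} (hm0 : 0 < m)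
    (hm : m ≤ 2 * p) : (A ^ m).trace = -(m * if m < p then 0 else k m) -
      ∑ r ∈ Finset.Ico 1 m, (if r < p then 0 else k r) * (A ^ (m - r)).trace := by
  rw [Matrix.trace_pow_eq A m hm0 (by simpa using hm), hA, Fintype.card_fin,
    evenPoly_coeff hm0 hm]
  congr 1
  refine Finset.sum_congr rfl fun r hr => ?_
  rw [Finset.mem_Ico] at hr
  rw [evenPoly_coeff (by omega) (by omega)]

theorem trace_pow_eq_zero_of_charpoly_eq_evenPoly (hA : A.charpoly = evenPoly p k) {m : ℕ}
    (hm0 : 0 < m) (hm : m < p) : (A ^ m).trace = 0 := by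
  rw [trace_pow_of_charpoly_eq_evenPoly hA hm0 (by omega), if_pos hm,
    Finset.sum_eq_zero fun r hr => ?_]
  · simp
  · rw [Finset.mem_Ico] at hr
    rw [if_pos (by omega), zero_mul]

theorem trace_pow_eq_neg_mul_of_charpoly_eq_evenPoly (hA : A.charpoly = evenPoly p k) {m : ℕ}
    (hm0 : 0 < m) (hpm : p ≤ m) (hm : m < 2 * p) : (A ^ m).trace = -(m * k m) := by
  rw [trace_pow_of_charpoly_eq_evenPoly hA hm0 hm.le, if_neg (by omega),
    Finset.sum_eq_zero fun r hr => ?_]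
  · simp
  · rw [Finset.mem_Ico] at hr
    split_ifs with h
    · simp
    · rw [trace_pow_eq_zero_of_charpoly_eq_evenPoly hA (by omega) (by omega), mul_zero]

theorem trace_pow_two_mul_of_charpoly_eq_evenPoly (hp : 1 < p) (hA : A.charpoly = evenPoly p k) :
    (A ^ (2 * p)).trace = p * k p ^ 2 - 2 * p * k (2 * p) := by
  rw [trace_pow_of_charpoly_eq_evenPoly hA (by omega) le_rfl, if_neg (by omega),
    -- For `r < p` the coefficient vanishes, for `r > p` the trace does.
    Finset.sum_eq_single p]
  · rw [if_neg (lt_irrefl p), show 2 * p - p = p by omega,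
      trace_pow_eq_neg_mul_of_charpoly_eq_evenPoly hA (by omega) le_rfl (by omega)]
    push_cast
    ring
  · intro r hr hrp
    rw [Finset.mem_Ico] at hr
    split_ifs with h
    · simp
    · rw [trace_pow_eq_zero_of_charpoly_eq_evenPoly hA (by omega) (by omega), mul_zero]
  · intro h
    rw [Finset.mem_Ico] at h
    omega

theorem nonpos_of_charpoly_eq_evenPoly (hnonneg : ∀ i j, 0 ≤ A i j)
    (hA : A.charpoly = evenPoly p k) {m : ℕ} (hm0 : 0 < m) (hpm : p ≤ m) (hm : m < 2 * p) :
    k m ≤ 0 := by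
  have h : 0 ≤ (A ^ m).trace :=
    Finset.sum_nonneg fun i _ => Matrix.pow_apply_nonneg hnonneg m i i
  rw [trace_pow_eq_neg_mul_of_charpoly_eq_evenPoly hA hm0 hpm hm] at h
  have : (0 : ℝ) < m := by exact_mod_cast hm0
  by_contra! hk
  have := mul_pos this hk
  linarith

/-- The centre `-k p / 2` is the mean of the diagonal of `A^p`, whose trace is `-p * k p`. -/
theorem sum_sq_diag_pow_le_of_charpoly_eq_evenPoly (hp : 1 < p) (hnonneg : ∀ i j, 0 ≤ A i j)
    (hA : A.charpoly = evenPoly p k) :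
    ∑ i, ((A ^ p) i i - -k p / 2) ^ 2 ≤ 2 * p * (k p ^ 2 / 4 - k (2 * p)) := by
  have h := Matrix.sum_sq_diag_sub_le (Matrix.pow_apply_nonneg hnonneg p) (-k p / 2)
  rw [← pow_add, ← two_mul, trace_pow_two_mul_of_charpoly_eq_evenPoly hp hA,
    trace_pow_eq_neg_mul_of_charpoly_eq_evenPoly hA (by omega) le_rfl (by omega),
    Fintype.card_fin] at h
  refine h.trans_eq ?_
  push_cast
  ring

theorem le_sq_div_four_of_charpoly_eq_evenPoly (hp : 1 < p) (hnonneg : ∀ i j, 0 ≤ A i j)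
    (hA : A.charpoly = evenPoly p k) : k (2 * p) ≤ k p ^ 2 / 4 := by
  have h := (Finset.sum_nonneg fun i _ => sq_nonneg _).trans
    (sum_sq_diag_pow_le_of_charpoly_eq_evenPoly hp hnonneg hA)
  have hp' : (0 : ℝ) < 2 * p := by positivity
  have := nonneg_of_mul_nonneg_right h hp'
  linarith

theorem IsExceptional.evenPoly_eq (hk : IsExceptional p k) (hp : 0 < p) :
    evenPoly p k = (X ^ p + C (k p / 2)) ^ 2 := by
  obtain ⟨-, h0, h1⟩ := hk
  have hsum : ∑ i ∈ Finset.Icc p (2 * p), C (k i) * X ^ (2 * p - i) =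
      C (k p) * X ^ p + C (k (2 * p)) := by
    rw [Finset.sum_eq_add p (2 * p) (by omega)]
    · rw [show 2 * p - p = p by omega]
      simp
    · intro i hi hne
      rw [Finset.mem_Icc] at hi
      rw [h0 i (by omega) (by omega), C_0, zero_mul]
    · intro h
      rw [Finset.mem_Icc] at h
      omega
    · intro h
      rw [Finset.mem_Icc] at h
      omega
  have h2 : (C (k p) : ℝ[X]) = 2 * C (k p / 2) := by
    rw [← C_ofNat, ← C_mul]
    congr 1
    ring
  have h3 : (C (k p ^ 2 / 4) : ℝ[X]) = C (k p / 2) ^ 2 := by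
    rw [← C_pow]
    congr 1
    ring
  rw [evenPoly, hsum, h1, h3, h2]
  ring

theorem IsExceptional.not_isIrreduciblyRealizable (hk : IsExceptional p k) (hp : 1 < p) :
    ¬ IsIrreduciblyRealizable (2 * p) (evenPoly p k) := by
  rintro ⟨A, hirr, hA⟩
  have hdiag : ∀ i, (A ^ p) i i = -k p / 2 := by
    have h := sum_sq_diag_pow_le_of_charpoly_eq_evenPoly hp hirr.nonneg hA
    rw [hk.2.2, sub_self, mul_zero] at h
    have h' := (Finset.sum_eq_zero_iff_of_nonneg fun i _ => sq_nonneg _).1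
      (h.antisymm (Finset.sum_nonneg fun i _ => sq_nonneg _))
    intro i
    have := h' i (Finset.mem_univ i)
    exact sub_eq_zero.1 (pow_eq_zero_iff two_ne_zero |>.1 this)
  -- Cayley–Hamilton for the square `(X^p + k_p/2)²`.
  have hsq : (A ^ p - (-k p / 2) • 1) * (A ^ p - (-k p / 2) • 1) = 0 := by
    have h := Matrix.aeval_self_charpoly A
    rw [hA, hk.evenPoly_eq (by omega)] at h
    rw [← sq, ← h]
    simp only [map_pow, map_add, aeval_X, aeval_C, Algebra.algebraMap_eq_smul_one]
    congr 1
    rw [sub_eq_add_neg, ← neg_smul]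
    congr 2
    ring
  have hzero := hirr.eq_zero_of_commute_of_mul_self_eq_zero (N := A ^ p - (-k p / 2) • 1)
    (fun i j => ?_) ?_ hsq
  · have hcard := hirr.card_le_of_pow_eq_smul_one (by omega : 0 < p)
      (by have := hk.1; intro h; linarith) (sub_eq_zero.1 hzero)
    rw [Fintype.card_fin] at hcard
    omega
  · by_cases hij : i = j
    · subst hij
      simp [hdiag]
    · simpa [Matrix.one_apply_ne hij] using Matrix.pow_apply_nonneg hirr.nonneg p i j
  · exact ((Commute.refl A).pow_left p).sub_left ((Commute.one_left A).smul_left _)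

end evenPoly

/-! ### Realization by looped paths -/

theorem isRealizable_hornerPoly_sub {n m : ℕ} (hm : m < n) {c : ℕ → ℝ}
    (hc : ∀ i, i < n → 0 ≤ c i) {d : ℝ} (hd : 0 ≤ d) :
    IsRealizable n (hornerPoly c n - C d * hornerPoly c m) := by
  obtain ⟨N, rfl⟩ : ∃ N, n = N + 1 := ⟨n - 1, by omega⟩
  exact ⟨_, loopedPathMatrix_nonneg hc hd, charpoly_loopedPathMatrix (by omega)⟩

theorem isIrreduciblyRealizable_hornerPoly_sub {n m l : ℕ} (hml : m ≤ l) (hl : l < n) {c : ℕ → ℝ}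
    (hc : ∀ i, i < n → 0 ≤ c i) (hcl : 0 < c l) {d : ℝ} (hd : 0 < d) :
    IsIrreduciblyRealizable n (hornerPoly c n - C d * hornerPoly c m) := by
  obtain ⟨N, rfl⟩ : ∃ N, n = N + 1 := ⟨n - 1, by omega⟩
  exact ⟨_, loopedPathMatrix_isIrreducible hc hd hml (by omega) hcl,
    charpoly_loopedPathMatrix (by omega)⟩

section evenPoly

variable {p : ℕ} {k : ℕ → ℝ}

theorem evenPoly_add_single (k : ℕ → ℝ) (e : ℝ) {l : ℕ} (hpl : p ≤ l) (hl : l ≤ 2 * p) :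
    evenPoly p (k + Pi.single l e) = evenPoly p k + C e * X ^ (2 * p - l) := by
  have h : ∑ i ∈ Finset.Icc p (2 * p), C ((Pi.single l e : ℕ → ℝ) i) * X ^ (2 * p - i) =
      C e * X ^ (2 * p - l) := by
    rw [Finset.sum_eq_single l]
    · simp
    · intro i _ hi
      simp [Pi.single_eq_of_ne hi]
    · intro h
      rw [Finset.mem_Icc] at h
      omega
  simp only [evenPoly, Pi.add_apply, C_add, add_mul, Finset.sum_add_distrib, h]
  ring

/-- The weights of the edges to `0` in a looped path matrix that prescribe the coefficients `k`
from `k p` on. -/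
def backWeight (p : ℕ) (k : ℕ → ℝ) (i : ℕ) : ℝ :=
  if i + 1 < p then 0 else -k (i + 1)

theorem backWeight_nonneg (hk : ∀ i, p ≤ i → i ≤ 2 * p → k i ≤ 0) {i : ℕ} (hi : i < 2 * p) :
    0 ≤ backWeight p k i := by
  rw [backWeight]
  split_ifs with h
  · rfl
  · have := hk (i + 1) (by omega) (by omega)
    linarith

theorem hornerPoly_backWeight_of_lt {m : ℕ} (hm : m < p) :
    hornerPoly (backWeight p k) m = X ^ m := by
  rw [hornerPoly_eq, Finset.sum_eq_zero, sub_zero]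
  intro i hi
  rw [Finset.mem_range] at hi
  rw [backWeight, if_pos (by omega), C_0, zero_mul]

theorem hornerPoly_backWeight_self (hp : 0 < p) :
    hornerPoly (backWeight p k) p = X ^ p + C (k p) := by
  obtain ⟨q, rfl⟩ : ∃ q, p = q + 1 := ⟨p - 1, by omega⟩
  rw [hornerPoly, hornerPoly_backWeight_of_lt (by omega), backWeight, if_neg (by omega), C_neg]
  ring

theorem hornerPoly_backWeight_two_mul (hp : 0 < p) :
    hornerPoly (backWeight p k) (2 * p) = evenPoly p k := by
  rw [hornerPoly_eq, evenPoly, sub_eq_add_neg, ← Finset.sum_neg_distrib]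
  congr 1
  have hsub : Finset.Icc p (2 * p) ⊆ Finset.Ico 1 (2 * p + 1) := by
    intro i hi
    rw [Finset.mem_Icc] at hi
    rw [Finset.mem_Ico]
    omega
  have h : ∀ i ∈ Finset.Icc p (2 * p), C (k i) * X ^ (2 * p - i) =
      (if i < p then 0 else C (k i) * X ^ (2 * p - i) : ℝ[X]) := by
    intro i hi
    rw [Finset.mem_Icc] at hi
    rw [if_neg (by omega)]
  rw [Finset.sum_congr rfl h, Finset.sum_subset hsub, Finset.sum_Ico_eq_sum_range]
  · refine Finset.sum_congr rfl fun i _ => ?_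
    rw [backWeight, add_comm 1 i, show 2 * p - (i + 1) = 2 * p - 1 - i by omega]
    split_ifs <;> simp
  · intro i hi hi'
    rw [Finset.mem_Ico] at hi
    rw [Finset.mem_Icc] at hi'
    rw [if_pos (by omega)]

/-- The coefficients left to the edges to `0` if two disjoint cycles of length `p` share the
weight `-k p` equally. -/
noncomputable def twoCycleCoeff (p : ℕ) (k : ℕ → ℝ) : ℕ → ℝ :=
  k + Pi.single p (-k p / 2 : ℝ) + Pi.single (2 * p) (-(k p ^ 2 / 4) : ℝ)

/-- Two cycles of length `p` with equal weights account for `k p` and for the maximal value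
`k p ^ 2 / 4` of the constant coefficient. -/
theorem evenPoly_eq_hornerPoly_sub_of_two_cycles (hp : 0 < p) (k : ℕ → ℝ) :
    evenPoly p k =
      hornerPoly (backWeight p (twoCycleCoeff p k))
        (2 * p) -
      C (-k p / 2) * hornerPoly
        (backWeight p (twoCycleCoeff p k)) p := by
  have h1 : twoCycleCoeff p k p =
      - (-k p / 2) := by
    rw [twoCycleCoeff, Pi.add_apply, Pi.add_apply, Pi.single_eq_same,
      Pi.single_eq_of_ne (by omega : p ≠ 2 * p)]
    ring
  have h2 : (C (-(k p ^ 2 / 4)) : ℝ[X]) = -C (-k p / 2) ^ 2 := by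
    rw [← C_pow, ← C_neg]
    congr 1
    ring
  rw [hornerPoly_backWeight_two_mul hp, hornerPoly_backWeight_self hp, h1, twoCycleCoeff,
    evenPoly_add_single _ _ (by omega) le_rfl, evenPoly_add_single _ _ le_rfl (by omega), h2,
    show 2 * p - p = p by omega, C_neg]
  simp only [tsub_self, pow_zero]
  ring

/-- Two overlapping cycles of length `l` account for `k l`. -/
theorem evenPoly_eq_hornerPoly_sub_of_long_cycles (k : ℕ → ℝ) {l : ℕ} (hpl : p < l)
    (hl : l ≤ 2 * p) :
    evenPoly p k =
      hornerPoly (backWeight p (k + Pi.single l (-k l / 2))) (2 * p) -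
      C (-k l / 2) * hornerPoly (backWeight p (k + Pi.single l (-k l / 2))) (2 * p - l) := by
  rw [hornerPoly_backWeight_two_mul (by omega), hornerPoly_backWeight_of_lt (by omega),
    evenPoly_add_single _ _ hpl.le hl]
  ring

theorem twoCycleCoeff_nonpos (hp : 0 < p) (hk : ∀ i, p ≤ i → i < 2 * p → k i ≤ 0)
    (hk' : k (2 * p) ≤ k p ^ 2 / 4) (i : ℕ) (hpi : p ≤ i) (hi : i ≤ 2 * p) :
    twoCycleCoeff p k i ≤ 0 := by
  rw [twoCycleCoeff, Pi.add_apply, Pi.add_apply, Pi.single_apply, Pi.single_apply]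
  split_ifs with h1 h2 h2
  · omega
  · subst h1
    have := hk i le_rfl (by omega)
    linarith
  · subst h2
    linarith
  · have := hk i hpi (by omega)
    linarith

theorem IsExceptional.isRealizable (hk : IsExceptional p k) (hp : 0 < p) :
    IsRealizable (2 * p) (evenPoly p k) := by
  rw [evenPoly_eq_hornerPoly_sub_of_two_cycles hp]
  refine isRealizable_hornerPoly_sub (by omega) (fun i hi => backWeight_nonneg ?_ hi) ?_
  · refine twoCycleCoeff_nonpos hp (fun i hpi hi => ?_) hk.2.2.le
    rcases hpi.eq_or_lt with rfl | hpi
    · exact hk.1.le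
    · exact (hk.2.1 i hpi hi).le
  · have := hk.1
    linarith

theorem isIrreduciblyRealizable_evenPoly (hp : 0 < p) (hP : evenPoly p k ≠ X ^ (2 * p))
    (hex : ¬ IsExceptional p k) (hk : ∀ i, p ≤ i → i < 2 * p → k i ≤ 0)
    (hk' : k (2 * p) ≤ k p ^ 2 / 4) : IsIrreduciblyRealizable (2 * p) (evenPoly p k) := by
  rcases (hk p le_rfl (by omega)).lt_or_eq with hkp | hkp
  -- A back edge from the second `p`-cycle is needed to connect it to the first; only the
  -- exceptional case has none.
  · obtain ⟨l, hpl, hl, hneg⟩ : ∃ l, p < l ∧ l ≤ 2 * p ∧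
        twoCycleCoeff p k l < 0 := by
      by_cases hmid : ∀ i, p < i → i < 2 * p → k i = 0
      · refine ⟨2 * p, by omega, le_rfl, ?_⟩
        rw [twoCycleCoeff, Pi.add_apply, Pi.add_apply, Pi.single_eq_same,
          Pi.single_eq_of_ne (by omega : 2 * p ≠ p)]
        have := hk'.lt_of_ne fun h => hex ⟨hkp, hmid, h⟩
        linarith
      · push Not at hmid
        obtain ⟨l, hpl, hl, hne⟩ := hmid
        refine ⟨l, hpl, hl.le, ?_⟩
        rw [twoCycleCoeff, Pi.add_apply, Pi.add_apply, Pi.single_eq_of_ne hl.ne,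
          Pi.single_eq_of_ne hpl.ne']
        simpa using (hk l hpl.le hl).lt_of_ne hne
    rw [evenPoly_eq_hornerPoly_sub_of_two_cycles hp]
    -- The back edge closing a cycle of length `l` leaves vertex `l - 1 ≥ p`.
    refine isIrreduciblyRealizable_hornerPoly_sub (l := l - 1) (by omega) (by omega)
      (fun i hi => backWeight_nonneg (twoCycleCoeff_nonpos hp hk hk') hi) ?_ (by linarith)
    rw [backWeight, if_neg (by omega), Nat.sub_add_cancel (by omega)]
    exact neg_pos.2 hneg
  · have hall : ∀ i, p ≤ i → i ≤ 2 * p → k i ≤ 0 := by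
      intro i hpi hi
      rcases hi.eq_or_lt with rfl | hi
      · simpa [hkp] using hk'
      · exact hk i hpi hi
    obtain ⟨l, hpl, hl, hneg⟩ : ∃ l, p < l ∧ l ≤ 2 * p ∧ k l < 0 := by
      by_contra! hno
      refine hP ?_
      rw [evenPoly, Finset.sum_eq_zero, add_zero]
      intro i hi
      rw [Finset.mem_Icc] at hi
      have : k i = 0 := by
        rcases hi.1.eq_or_lt with rfl | hpi
        · exact hkp
        · exact (hall i hi.1 hi.2).antisymm (hno i hpi hi.2)
      rw [this, C_0, zero_mul]
    rw [evenPoly_eq_hornerPoly_sub_of_long_cycles k hpl hl]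
    -- The two `l`-cycles overlap: `2 * p - l ≤ l - 1` because `l > p`.
    refine isIrreduciblyRealizable_hornerPoly_sub (l := l - 1) (by omega) (by omega)
      (fun i hi => backWeight_nonneg (fun j hpj hj => ?_) hi) ?_ (by linarith)
    · rw [Pi.add_apply, Pi.single_apply]
      have := hall j hpj hj
      split_ifs with h
      · subst h
        linarith
      · linarith
    · rw [backWeight, if_neg (by omega), Nat.sub_add_cancel (by omega), Pi.add_apply,
        Pi.single_eq_same]
      linarith

end evenPoly

theorem theorem27 (p : ℕ) (hp : 3 ≤ p) (k : ℕ → ℝ) (hP : evenPoly p k ≠ X ^ (2 * p)) :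
    (¬ IsExceptional p k →
      (IsRealizable (2 * p) (evenPoly p k) ↔ IsIrreduciblyRealizable (2 * p) (evenPoly p k))) ∧
    (IsExceptional p k →
      evenPoly p k = (X ^ p + C (k p / 2)) ^ 2 ∧
      IsRealizable (2 * p) (evenPoly p k) ∧
      ¬ IsIrreduciblyRealizable (2 * p) (evenPoly p k)) := by
  refine ⟨fun hex => ⟨?_, fun ⟨A, hirr, hA⟩ => ⟨A, hirr.nonneg, hA⟩⟩, fun hk =>
    ⟨hk.evenPoly_eq (by omega), hk.isRealizable (by omega),
      hk.not_isIrreduciblyRealizable (by omega)⟩⟩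
  rintro ⟨A, hnonneg, hA⟩
  exact isIrreduciblyRealizable_evenPoly (by omega) hP hex
    (fun i hpi hi => nonpos_of_charpoly_eq_evenPoly hnonneg hA (by omega) hpi hi)
    (le_sq_div_four_of_charpoly_eq_evenPoly (by omega) hnonneg hA)
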